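/- Let $\mathcal H_A,\mathcal H_B$ be complex Hilbert spaces and $\mathcal H=\mathcal H_A\otimes\mathcal H_B$ their Hilbert space tensor product. Let $\mathcal S$ be the set of separable states, i.e. the closure in trace norm of the convex hull of all $|\psi_A\otimes\psi_B\rangle\langle\psi_A\otimes\psi_B|$ with unit vectors $\psi_A\in\mathcal H_A$, $\psi_B\in\mathcal H_B$. Let $\mathcal D(\mathcal H)$ be the set of density operators. For $\rho\in\mathcal D(\mathcal H)$ define the generalized robustness of entanglement $\underline{R}_{\mathcal S}(\rho)\in[1,\infty]$ as the infimum of all $1+\lambda$, $\lambda\ge 0$, for which there exist bounded operators $\xi_k$ with $\|\xi_k-\rho\|_1\to 0$ and $\tau_k\in\mathcal D(\mathcal H)$ such that $\frac{\xi_k+\lambda\tau_k}{1+\lambda}\in\mathcal S$ for all $k$. Let $R_{\mathcal S}(\rho)$ be the infimum of all $1+\lambda$, $\lambda\ge0$, for which there exists $\tau\in\mathcal D(\mathcal H)$ with $\frac{\rho+\lambda\tau}{1+\lambda}\in\mathcal S$. In both cases $\inf\emptyset=\infty$. (1) Let $\psi\in\mathcal H$ be a unit vector with Schmidt decomposition $\psi=\sum_n\mu_n\,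 e_n\otimes f_n$, where $\mu_n\ge 0$, $(e_n)$ is an orthonormal family in $\mathcal H_A$ and $(f_n)$ is an orthonormal family in $\mathcal H_B$ (over any common index set, for instance $n=1,2,\dots$). Then $$\underline{R}_{\mathcal S}(|\psi\rangle\langle\psi|)=R_{\mathcal S}(|\psi\rangle\langle\psi|)=\Big(\sum_n\mu_n\Big)^2\in[1,\infty].$$ In particular $\underline{R}_{\mathcal S}(|\psi\rangle\langle\psi|)<\infty$ if and only if $\sum_n\mu_n$ converges. (2) Let $(|n\rangle)_{n\ge0}$ denote orthonormal (Fock) bases of $\mathcal H_A$ and of $\mathcal H_B$, and for $r\ge0$ let $$|\nu_r\rangle=e^{\frac r2(a^\dagger b^\dagger-ab)}|00\rangle=\frac{1}{\cosh(r/2)}\sum_{n=0}^\infty\tanh^n(r/2)\,|nn\rangle$$ be the two-mode squeezed vacuum, the Fock expansion on the right being taken as its definition. Then $\nu_r$ is a unit vector and $\underline{R}_{\mathcal S}(|\nu_r\rangle\langle\nu_r|)=R_{\mathcal S}(|\nu_r\rangle\langle\nu_r|)=e^r$. -/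

import Mathlib

open scoped TensorProduct InnerProductSpace ENNReal Topology
open Filter

noncomputable section

namespace QuantumRobustness

section General

variable {K : Type*} [NormedAddCommGroup K] [InnerProductSpace ℂ K] [CompleteSpace K]

/-- The trace of a positive operator `T`, with values in `[0, ∞]`: the supremum of the sums
`∑ ⟨x, T x⟩` over finite orthonormal families. For `T ≥ 0` this is `∑ ⟨b i, T (b i)⟩` for each
orthonormal basis `b` of `K`. Only used for positive operators. -/
def posTrace (T : K →L[ℂ] K) : ℝ≥0∞ :=
  ⨆ (s : Finset K) (_ : Orthonormal ℂ (fun x : s => (x : K))),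
    ∑ x ∈ s, ENNReal.ofReal (⟪x, T x⟫_ℂ).re

/-- The trace norm `‖T‖₁ = Tr |T|`, where `|T| = (T† T)^(1/2)`. It is `∞` exactly when the bounded
operator `T` is not of trace class. -/
def traceNorm (T : K →L[ℂ] K) : ℝ≥0∞ := posTrace (CFC.abs T)

/-- Density operators: positive operators of trace one. -/
def densityOperators (K : Type*) [NormedAddCommGroup K] [InnerProductSpace ℂ K]
    [CompleteSpace K] : Set (K →L[ℂ] K) :=
  {T | T.IsPositive ∧ posTrace T = 1}

/-- The closure of a set of operators with respect to the trace norm. -/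
def traceClosure (C : Set (K →L[ℂ] K)) : Set (K →L[ℂ] K) :=
  {T | ∀ ε : ℝ≥0∞, 0 < ε → ∃ S ∈ C, traceNorm (T - S) < ε}

/-- The closed convex hull `cl conv C`, the closure being taken in the trace norm. -/
def traceClosedConvexHull (C : Set (K →L[ℂ] K)) : Set (K →L[ℂ] K) :=
  traceClosure (convexHull ℝ C)

/-- The operator `|ψ⟩⟨ψ|`. -/
def proj (ψ : K) : K →L[ℂ] K := InnerProductSpace.rankOne ℂ ψ ψ

/-- The generalized robustness of `ρ` with respect to the free set `F`, without sequences: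
the infimum of `1 + r`, `r ≥ 0`, such that `(ρ + r τ) / (1 + r) ∈ F` for some density
operator `τ`. The infimum over the empty set is `∞`. -/
def plainRobustness (F : Set (K →L[ℂ] K)) (ρ : K →L[ℂ] K) : ℝ≥0∞ :=
  sInf {x : ℝ≥0∞ | ∃ r : ℝ, 0 ≤ r ∧ x = ENNReal.ofReal (1 + r) ∧
    ∃ τ ∈ densityOperators K, ((1 + r : ℝ) : ℂ)⁻¹ • (ρ + (r : ℂ) • τ) ∈ F}

/-- The generalized robustness of `ρ` with respect to the free set `F`:
the infimum of `1 + r`, `r ≥ 0`, such that there are bounded operators `ξ k` converging to `ρ` in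
trace norm and density operators `τ k` with `(ξ k + r τ k) / (1 + r) ∈ F` for all `k`.
The infimum over the empty set is `∞`. -/
def robustness (F : Set (K →L[ℂ] K)) (ρ : K →L[ℂ] K) : ℝ≥0∞ :=
  sInf {x : ℝ≥0∞ | ∃ r : ℝ, 0 ≤ r ∧ x = ENNReal.ofReal (1 + r) ∧
    ∃ ξ τ : ℕ → (K →L[ℂ] K), Tendsto (fun k => traceNorm (ξ k - ρ)) atTop (𝓝 0) ∧
      ∀ k, τ k ∈ densityOperators K ∧ ((1 + r : ℝ) : ℂ)⁻¹ • (ξ k + (r : ℂ) • τ k) ∈ F}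

end General

section Bipartite

/-- The Hilbert space tensor product: the completion of the algebraic tensor product with respect
to the inner product `⟨a ⊗ b, a' ⊗ b'⟩ = ⟨a, a'⟩ ⟨b, b'⟩`. -/
abbrev HilbertTensor (A B : Type*) [NormedAddCommGroup A] [InnerProductSpace ℂ A]
    [NormedAddCommGroup B] [InnerProductSpace ℂ B] : Type _ :=
  UniformSpace.Completion (A ⊗[ℂ] B)

variable {A B : Type*} [NormedAddCommGroup A] [InnerProductSpace ℂ A]
  [NormedAddCommGroup B] [InnerProductSpace ℂ B]

/-- The product vector `a ⊗ b` in the Hilbert space tensor product. -/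
def tensorVec (a : A) (b : B) : HilbertTensor A B := ((a ⊗ₜ[ℂ] b : A ⊗[ℂ] B) : HilbertTensor A B)

/-- Separable states: the trace norm closed convex hull of the pure product states. -/
def separableStates (A B : Type*) [NormedAddCommGroup A] [InnerProductSpace ℂ A]
    [NormedAddCommGroup B] [InnerProductSpace ℂ B] :
    Set (HilbertTensor A B →L[ℂ] HilbertTensor A B) :=
  traceClosedConvexHull
    {T | ∃ (a : A) (b : B), ‖a‖ = 1 ∧ ‖b‖ = 1 ∧ T = proj (tensorVec a b)}

/-- `ψ = ∑ μ n • (e n ⊗ f n)` is a Schmidt decomposition of the vector `ψ`. -/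
structure IsSchmidtDecomposition {ι : Type*} (ψ : HilbertTensor A B) (μ : ι → ℝ)
    (e : ι → A) (f : ι → B) : Prop where
  nonneg : ∀ n, 0 ≤ μ n
  orthonormal_left : Orthonormal ℂ e
  orthonormal_right : Orthonormal ℂ f
  hasSum : HasSum (fun n => (μ n : ℂ) • tensorVec (e n) (f n)) ψ

/-- The two-mode squeezed vacuum state vector
`exp ((r / 2) (a† b† - a b)) |00⟩ = (cosh (r / 2))⁻¹ ∑ (tanh (r / 2)) ^ n |nn⟩`,
where `|n⟩` are the Fock bases `b₁` and `b₂` of the two modes. -/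
def twoModeSqueezedVacuum (b₁ : HilbertBasis ℕ ℂ A) (b₂ : HilbertBasis ℕ ℂ B) (r : ℝ) :
    HilbertTensor A B :=
  ∑' n : ℕ, ((Real.tanh (r / 2) ^ n / Real.cosh (r / 2) : ℝ) : ℂ) • tensorVec (b₁ n) (b₂ n)

end Bipartite

end QuantumRobustness

end

namespace QuantumRobustness

/-! ### Trace and trace norm of positive operators -/

section Trace

variable {K : Type*} [NormedAddCommGroup K] [InnerProductSpace ℂ K]

/-! Since `robustness ≤ plainRobustness`, it suffices to bound the former below and the latter above
by `(∑ μ n)²`.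

Lower bound: for finite `s` put `φ = ∑_{n ∈ s} e n ⊗ f n`. Cauchy–Schwarz and Bessel give `|⟨φ, a ⊗
b⟩| ≤ 1` for unit `a`, `b`, so `⟨φ, σ φ⟩ ≤ 1` on every separable `σ`. Evaluating `⟨φ, · φ⟩` on `ξ k
+ r τ k` and dropping the nonnegative `τ k` term gives `⟨φ, ρ φ⟩ ≤ 1 + r` in the limit
(`le_robustness_of_witness`). For `ρ = |ψ⟩⟨ψ|` the left side is `(∑_{n ∈ s} μ n)²`; then let `s`
grow.

Upper bound: if `M = ∑ μ n < ∞`, the state `σ = ∑ (μ n / M) |e n ⊗ f n⟩⟨e n ⊗ f n|` is separable and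
weighted Cauchy–Schwarz gives `|ψ⟩⟨ψ| ≤ M² σ`. The normalized difference `t σ - |ψ⟩⟨ψ|`, for `t >
M²`, is an admissible `τ` (`plainRobustness_proj_le`). If `M = ∞` nothing is left to prove. The
squeezed vacuum is the geometric case. -/

theorem _root_.HilbertBasis.tsum_ofReal_norm_inner_sq {ι : Type*} (b : HilbertBasis ι ℂ K) (x : K) :
    ∑' i, ENNReal.ofReal (‖⟪b i, x⟫_ℂ‖ ^ 2) = ENNReal.ofReal (‖x‖ ^ 2) := by
  have h := Complex.hasSum_re (b.hasSum_inner_mul_inner x x)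
  have h' : HasSum (fun i => ‖⟪b i, x⟫_ℂ‖ ^ 2) (‖x‖ ^ 2) := by
    convert h using 1
    · ext i
      rw [← inner_conj_symm x (b i), Complex.conj_mul']
      norm_cast
    · rw [inner_self_eq_norm_sq_to_K]
      norm_cast
  rw [← h'.tsum_eq, ENNReal.ofReal_tsum_of_nonneg (fun _ => by positivity) h'.summable]

theorem posTrace_real_smul {c : ℝ} (hc : 0 ≤ c) (T : K →L[ℂ] K) :
    posTrace ((c : ℂ) • T) = ENNReal.ofReal c * posTrace T := by
  unfold posTrace
  simp_rw [ENNReal.mul_iSup, Finset.mul_sum]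
  refine iSup_congr fun s => iSup_congr fun _ => Finset.sum_congr rfl fun x _ => ?_
  rw [smul_apply, inner_smul_right, Complex.re_ofReal_mul, ENNReal.ofReal_mul hc]

variable [CompleteSpace K]

theorem inner_eq_norm_sqrt_sq {T : K →L[ℂ] K} (hT : T.IsPositive) (x : K) :
    (⟪x, T x⟫_ℂ).re = ‖CFC.sqrt T x‖ ^ 2 := by
  have h0 : 0 ≤ T := (ContinuousLinearMap.nonneg_iff_isPositive T).2 hT
  have hsa : IsSelfAdjoint (CFC.sqrt T) := (CFC.sqrt_nonneg T).isSelfAdjoint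
  have h : T x = CFC.sqrt T (CFC.sqrt T x) := by
    conv_lhs => rw [← CFC.sqrt_mul_sqrt_self T h0]
    rfl
  rw [h, ← hsa.isSymmetric.apply_clm, inner_self_eq_norm_sq_to_K]
  norm_cast

/-- The trace of a positive operator is computed by any Hilbert basis. -/
theorem posTrace_eq_tsum {ι : Type*} (b : HilbertBasis ι ℂ K) {T : K →L[ℂ] K}
    (hT : T.IsPositive) :
    posTrace T = ∑' i, ENNReal.ofReal (⟪b i, T (b i)⟫_ℂ).re := by
  classical
  apply le_antisymm
  · refine iSup₂_le fun s hs => ?_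
    have hsa : IsSelfAdjoint (CFC.sqrt T) := (CFC.sqrt_nonneg T).isSelfAdjoint
    calc ∑ x ∈ s, ENNReal.ofReal (⟪x, T x⟫_ℂ).re
        = ∑ x ∈ s, ∑' i, ENNReal.ofReal (‖⟪b i, CFC.sqrt T x⟫_ℂ‖ ^ 2) := by
          simp_rw [inner_eq_norm_sqrt_sq hT, b.tsum_ofReal_norm_inner_sq]
      _ = ∑' i, ∑ x ∈ s, ENNReal.ofReal (‖⟪b i, CFC.sqrt T x⟫_ℂ‖ ^ 2) :=
          (Summable.tsum_finsetSum fun _ _ => ENNReal.summable).symm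
      _ ≤ ∑' i, ENNReal.ofReal (⟪b i, T (b i)⟫_ℂ).re := by
          refine ENNReal.tsum_le_tsum fun i => ?_
          rw [← ENNReal.ofReal_sum_of_nonneg fun _ _ => by positivity, inner_eq_norm_sqrt_sq hT]
          refine ENNReal.ofReal_le_ofReal ?_
          -- Bessel for the family `s`, applied to `√T (b i)`; self-adjointness of `√T` moves it
          -- across the inner product.
          have := hs.sum_inner_products_le (s := Finset.univ) (CFC.sqrt T (b i))
          rw [Finset.sum_coe_sort s (fun x => ‖⟪x, CFC.sqrt T (b i)⟫_ℂ‖ ^ 2)] at this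
          refine le_trans (le_of_eq (Finset.sum_congr rfl fun x _ => ?_)) this
          rw [← hsa.isSymmetric.apply_clm, norm_inner_symm]
  · rw [ENNReal.tsum_eq_iSup_sum]
    refine iSup_le fun s => ?_
    have hinj : Function.Injective b := b.orthonormal.linearIndependent.injective
    have hs : Orthonormal ℂ (fun x : s.image b => (x : K)) := by
      have := b.orthonormal.toSubtypeRange
      exact this.comp (fun x : s.image b => ⟨x, by
        obtain ⟨i, _, hi⟩ := Finset.mem_image.1 x.2
        exact ⟨i, hi⟩⟩) fun x y h => Subtype.ext (by simpa using h)
    refine le_trans (le_of_eq ?_) (le_iSup₂ (s.image b) hs)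
    rw [Finset.sum_image fun _ _ _ _ h => hinj h]

/-- A supremum over families is not visibly additive; a fixed Hilbert basis makes it so. -/
theorem posTrace_add {S T : K →L[ℂ] K} (hS : S.IsPositive) (hT : T.IsPositive) :
    posTrace (S + T) = posTrace S + posTrace T := by
  obtain ⟨w, b, -⟩ := exists_hilbertBasis ℂ K
  rw [posTrace_eq_tsum b (hS.add hT), posTrace_eq_tsum b hS, posTrace_eq_tsum b hT,
    ← ENNReal.tsum_add]
  refine tsum_congr fun i => ?_
  rw [add_apply, inner_add_right, Complex.add_re,
    ENNReal.ofReal_add (by exact hS.re_inner_nonneg_right _)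
      (by exact hT.re_inner_nonneg_right _)]

/-- A single unit vector `x` is an orthonormal family, so `‖√T x‖² ≤ Tr T`, and `‖T‖ ≤ ‖√T‖²`. -/
theorem ofReal_norm_le_posTrace {T : K →L[ℂ] K} (hT : T.IsPositive) :
    ENNReal.ofReal ‖T‖ ≤ posTrace T := by
  rcases eq_or_ne (posTrace T) ⊤ with h | h
  · simp [h]
  refine ENNReal.ofReal_le_of_le_toReal ?_
  have h0 : 0 ≤ T := (ContinuousLinearMap.nonneg_iff_isPositive T).2 hT
  set c := (posTrace T).toReal
  have key : ∀ x : K, ‖x‖ = 1 → ‖CFC.sqrt T x‖ ≤ √c := fun x hx => by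
    refine Real.le_sqrt_of_sq_le ?_
    rw [← inner_eq_norm_sqrt_sq hT]
    refine (ENNReal.ofReal_le_iff_le_toReal h).1 ?_
    have hs : Orthonormal ℂ (fun y : ({x} : Finset K) => (y : K)) := by
      refine ⟨fun y => ?_, fun y z hyz => absurd (Subsingleton.elim y z) hyz⟩
      obtain ⟨y, hy⟩ := y
      rw [Finset.mem_singleton] at hy
      simpa [hy] using hx
    refine le_trans (le_of_eq ?_) (le_iSup₂ ({x} : Finset K) hs)
    rw [Finset.sum_singleton]
  have hR : ‖CFC.sqrt T‖ ≤ √c :=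
    ContinuousLinearMap.opNorm_le_of_unit_norm (𝕜 := ℂ) (Real.sqrt_nonneg c) key
  calc ‖T‖ = ‖CFC.sqrt T * CFC.sqrt T‖ := by rw [CFC.sqrt_mul_sqrt_self T h0]
    _ ≤ ‖CFC.sqrt T‖ * ‖CFC.sqrt T‖ := norm_mul_le _ _
    _ ≤ √c * √c := by gcongr
    _ = c := Real.mul_self_sqrt ENNReal.toReal_nonneg

/-- Reduces trace norm limits to operator norm limits, where quadratic forms are continuous. -/
theorem ofReal_norm_le_traceNorm (T : K →L[ℂ] K) : ENNReal.ofReal ‖T‖ ≤ traceNorm T := by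
  have h := ofReal_norm_le_posTrace
    ((ContinuousLinearMap.nonneg_iff_isPositive _).1 (CFC.abs_nonneg T))
  rwa [CFC.norm_abs] at h

end Trace

/-! ### Operators diagonal in an orthonormal family -/

section Diagonal

variable {K : Type*} [NormedAddCommGroup K] [InnerProductSpace ℂ K] [CompleteSpace K]
  {ι : Type*} {g : ι → K} {c d : ι → ℝ}

/-- The operator `∑ c n |g n⟩⟨g n|`. -/
noncomputable def diagonalOperator (g : ι → K) (c : ι → ℝ) : K →L[ℂ] K := ∑' n, (c n : ℂ) • proj (g n)

theorem hasSum_diagonalOperator (hg : Orthonormal ℂ g) (hc : Summable c) :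
    HasSum (fun n => (c n : ℂ) • proj (g n)) (diagonalOperator g c) := by
  refine (Summable.of_norm ?_).hasSum
  refine hc.norm.congr fun n => ?_
  rw [norm_smul, proj, InnerProductSpace.norm_rankOne, hg.1, Complex.norm_real, mul_one, mul_one]

theorem hasSum_diagonalOperator_apply (hg : Orthonormal ℂ g) (hc : Summable c) (x : K) :
    HasSum (fun n => ((c n : ℂ) * ⟪g n, x⟫_ℂ) • g n) (diagonalOperator g c x) := by
  have := (hasSum_diagonalOperator hg hc).mapL (ContinuousLinearMap.apply ℂ K x)
  exact HasSum.congr_fun this fun n => by simp [proj, mul_smul]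

theorem hasSum_inner_diagonalOperator (hg : Orthonormal ℂ g) (hc : Summable c) (x : K) :
    HasSum (fun n => c n * ‖⟪g n, x⟫_ℂ‖ ^ 2) (⟪x, diagonalOperator g c x⟫_ℂ).re := by
  have := Complex.hasSum_re ((hasSum_diagonalOperator_apply hg hc x).mapL (innerSL ℂ x))
  refine HasSum.congr_fun this fun n => ?_
  rw [innerSL_apply_apply, inner_smul_right, mul_assoc, ← inner_conj_symm x (g n),
    Complex.mul_conj', Complex.re_ofReal_mul]
  norm_cast

theorem inner_diagonalOperator (hg : Orthonormal ℂ g) (hc : Summable c) (n : ι) (x : K) :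
    ⟪g n, diagonalOperator g c x⟫_ℂ = c n * ⟪g n, x⟫_ℂ := by
  classical
  have := (hasSum_diagonalOperator_apply hg hc x).mapL (innerSL ℂ (g n))
  refine this.unique ?_
  refine HasSum.congr_fun (hasSum_ite_eq n ((c n : ℂ) * ⟪g n, x⟫_ℂ)) fun m => ?_
  rw [innerSL_apply_apply, inner_smul_right, orthonormal_iff_ite.1 hg]
  by_cases h : m = n
  · simp [h]
  · simp [h, Ne.symm h]

theorem isSelfAdjoint_diagonalOperator (g : ι → K) (c : ι → ℝ) :
    IsSelfAdjoint (diagonalOperator g c) := by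
  rw [IsSelfAdjoint, diagonalOperator, tsum_star]
  refine tsum_congr fun n => ?_
  rw [star_smul, proj, ContinuousLinearMap.star_eq_adjoint, InnerProductSpace.adjoint_rankOne]
  simp

theorem isPositive_diagonalOperator (hg : Orthonormal ℂ g) (hc : Summable c) (h0 : ∀ n, 0 ≤ c n) :
    (diagonalOperator g c).IsPositive := by
  refine ContinuousLinearMap.isPositive_def'.2 ⟨isSelfAdjoint_diagonalOperator g c, fun x => ?_⟩
  rw [ContinuousLinearMap.reApplyInnerSelf_apply, inner_re_symm]
  exact (hasSum_inner_diagonalOperator hg hc x).nonneg fun n => by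
    have := h0 n
    positivity

theorem diagonalOperator_mul (hg : Orthonormal ℂ g) (hc : Summable c) (hd : Summable d) :
    diagonalOperator g c * diagonalOperator g d = diagonalOperator g (fun n => c n * d n) := by
  ext x
  have hcd : Summable fun n => c n * d n := by
    -- A summable `c` tends to zero, so `|c n| < 1` off a finite set and `d` dominates the product.
    refine Summable.of_norm_bounded_eventually (g := fun n => ‖d n‖) hd.norm ?_
    filter_upwards [hc.tendsto_cofinite_zero.eventually (Metric.ball_mem_nhds 0 one_pos)] with n hn
    rw [norm_mul]
    have : ‖c n‖ < 1 := by simpa using hn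
    nlinarith [norm_nonneg (d n)]
  refine (hasSum_diagonalOperator_apply hg hc _).unique ?_
  refine HasSum.congr_fun (hasSum_diagonalOperator_apply hg hcd x) fun n => ?_
  rw [ContinuousLinearMap.coe_coe, inner_diagonalOperator hg hd]
  push_cast
  rw [mul_assoc]

/-- The operator with entries `|c n|` is positive and has the same square, so it is the positive
square root. -/
theorem abs_diagonalOperator (hg : Orthonormal ℂ g) (hc : Summable c) :
    CFC.abs (diagonalOperator g c) = diagonalOperator g (fun n => |c n|) := by
  have h0 : 0 ≤ diagonalOperator g (fun n => |c n|) :=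
    (ContinuousLinearMap.nonneg_iff_isPositive _).2
      (isPositive_diagonalOperator hg hc.abs fun n => abs_nonneg _)
  rw [CFC.abs, (isSelfAdjoint_diagonalOperator g c).star_eq, diagonalOperator_mul hg hc hc]
  simp_rw [← abs_mul_abs_self (c _)]
  rw [← diagonalOperator_mul hg hc.abs hc.abs, CFC.sqrt_mul_self _ h0]

/-- In a Hilbert basis the trace is a double series of terms `c n ‖⟪b i, g n⟫‖²`; exchanging the
sums in `[0, ∞]` and applying Parseval leaves `∑ c n`. -/
theorem posTrace_diagonalOperator (hg : Orthonormal ℂ g) (hc : Summable c) (h0 : ∀ n, 0 ≤ c n) :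
    posTrace (diagonalOperator g c) = ∑' n, ENNReal.ofReal (c n) := by
  obtain ⟨w, b, -⟩ := exists_hilbertBasis ℂ K
  rw [posTrace_eq_tsum b (isPositive_diagonalOperator hg hc h0)]
  have h (i : w) : ENNReal.ofReal (⟪b i, diagonalOperator g c (b i)⟫_ℂ).re =
      ∑' n, ENNReal.ofReal (c n) * ENNReal.ofReal (‖⟪b i, g n⟫_ℂ‖ ^ 2) := by
    have := hasSum_inner_diagonalOperator hg hc (b i)
    rw [← this.tsum_eq, ENNReal.ofReal_tsum_of_nonneg _ this.summable]
    · refine tsum_congr fun n => ?_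
      rw [ENNReal.ofReal_mul (h0 n), norm_inner_symm]
    · intro n
      have := h0 n
      positivity
  simp_rw [h]
  rw [ENNReal.tsum_comm]
  refine tsum_congr fun n => ?_
  rw [ENNReal.tsum_mul_left, b.tsum_ofReal_norm_inner_sq, hg.1]
  simp

theorem traceNorm_diagonalOperator (hg : Orthonormal ℂ g) (hc : Summable c) :
    traceNorm (diagonalOperator g c) = ∑' n, ENNReal.ofReal |c n| := by
  rw [traceNorm, abs_diagonalOperator hg hc,
    posTrace_diagonalOperator hg hc.abs fun _ => abs_nonneg _]

theorem diagonalOperator_sub (hg : Orthonormal ℂ g) (hc : Summable c) (hd : Summable d) :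
    diagonalOperator g c - diagonalOperator g d = diagonalOperator g (fun n => c n - d n) := by
  refine ((hasSum_diagonalOperator hg hc).sub (hasSum_diagonalOperator hg hd)).unique ?_
  refine HasSum.congr_fun (hasSum_diagonalOperator hg (hc.sub hd)) fun n => ?_
  rw [← sub_smul, Complex.ofReal_sub]

theorem posTrace_proj {ψ : K} (hψ : ‖ψ‖ = 1) : posTrace (proj ψ) = 1 := by
  have hg : Orthonormal ℂ (fun _ : Unit => ψ) :=
    ⟨fun _ => hψ, fun i j h => absurd (Subsingleton.elim i j) h⟩
  have h : diagonalOperator (fun _ : Unit => ψ) (fun _ => 1) = proj ψ := by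
    simp [diagonalOperator]
  rw [← h, posTrace_diagonalOperator hg Summable.of_finite fun _ => zero_le_one]
  simp

/-- A countable mixture of orthogonal pure states lies in the trace norm closed convex hull. -/
theorem diagonalOperator_mem_traceClosedConvexHull (hg : Orthonormal ℂ g) (h0 : ∀ n, 0 ≤ c n)
    (hc : HasSum c 1) {C : Set (K →L[ℂ] K)} (hC : ∀ n, proj (g n) ∈ C) :
    diagonalOperator g c ∈ traceClosedConvexHull C := by
  classical
  intro ε hε
  -- `2 * (1 - ∑_{n ∈ s} c n)` is the trace distance from the mixture to its truncation to `s`,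
  -- renormalized to weight one (`d` below).
  have hlim : Tendsto (fun s : Finset ι => ENNReal.ofReal (2 * (1 - ∑ n ∈ s, c n))) atTop (𝓝 0) := by
    have := ENNReal.tendsto_ofReal ((hc.const_sub 1).const_mul 2)
    simpa using this
  obtain ⟨s, hs, hpos⟩ := ((hlim.eventually (gt_mem_nhds hε)).and
    (hc.eventually (lt_mem_nhds one_pos))).exists
  set P := ∑ n ∈ s, c n with hP
  have hP1 : P ≤ 1 := sum_le_hasSum s (fun n _ => h0 n) hc
  let d : ι → ℝ := fun n => if n ∈ s then c n / P else 0
  have hd : HasSum d 1 := by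
    have : ∑ n ∈ s, d n = 1 := by
      rw [Finset.sum_congr rfl fun n hn => (if_pos hn : d n = c n / P), ← Finset.sum_div, ← hP,
        div_self hpos.ne']
    rw [← this]
    exact hasSum_sum_of_ne_finset_zero fun n hn => if_neg hn
  refine ⟨diagonalOperator g d, ?_, ?_⟩
  · have : diagonalOperator g d = ∑ n ∈ s, d n • proj (g n) := by
      rw [diagonalOperator, tsum_eq_sum (s := s) fun n hn => by simp [d, hn]]
      simp
    rw [this]
    refine (convex_convexHull ℝ C).sum_mem (fun n hn => ?_) ?_ fun n _ => subset_convexHull ℝ C (hC n)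
    · have := h0 n
      simp only [d, if_pos hn]
      positivity
    · rw [Finset.sum_congr rfl fun n hn => (if_pos hn : d n = c n / P), ← Finset.sum_div, ← hP,
        div_self hpos.ne']
  · rw [diagonalOperator_sub hg hc.summable hd.summable,
      traceNorm_diagonalOperator hg (hc.summable.sub hd.summable)]
    have htail : HasSum (fun n => if n ∈ s then 0 else c n) (1 - P) := by
      have hfin : HasSum (fun n => if n ∈ s then c n else 0) P := by
        rw [hP, Finset.sum_congr rfl fun n hn => (if_pos hn : (if n ∈ s then c n else 0) = c n).symm]
        exact hasSum_sum_of_ne_finset_zero fun n hn => if_neg hn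
      refine HasSum.congr_fun (hc.sub hfin) fun n => ?_
      split_ifs <;> ring
    have habs : HasSum (fun n => |c n - d n|) (2 * (1 - P)) := by
      -- Pointwise `|c - d| = (d - c) + 2 · (tail of c)`: on `s`, `d ≥ c` because `P ≤ 1`; off `s`,
      -- `d = 0`. The first bracket sums to `1 - 1`.
      rw [show 2 * (1 - P) = 1 - 1 + 2 * (1 - P) by ring]
      refine HasSum.congr_fun ((hd.sub hc).add (htail.mul_left 2)) fun n => ?_
      by_cases hn : n ∈ s
      · have : c n ≤ c n / P := le_div_self (h0 n) hpos hP1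
        simp [d, hn, abs_of_nonpos (sub_nonpos.2 this)]
      · simp only [d, hn, if_false, sub_zero, abs_of_nonneg (h0 n)]
        ring
    rwa [← ENNReal.ofReal_tsum_of_nonneg (fun _ => abs_nonneg _) habs.summable, habs.tsum_eq]

end Diagonal

/-! ### Witness lower bound and domination upper bound -/

section Robustness

variable {K : Type*} [NormedAddCommGroup K] [InnerProductSpace ℂ K] [CompleteSpace K]

theorem robustness_le_plainRobustness (F : Set (K →L[ℂ] K)) (ρ : K →L[ℂ] K) :
    robustness F ρ ≤ plainRobustness F ρ := by
  refine sInf_le_sInf ?_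
  rintro x ⟨r, hr, hx, τ, hτ, h⟩
  refine ⟨r, hr, hx, fun _ => ρ, fun _ => τ, ?_, fun _ => ⟨hτ, h⟩⟩
  have : traceNorm (0 : K →L[ℂ] K) = 0 := by simp [traceNorm, posTrace]
  simp [this]

theorem continuous_re_inner_apply (φ : K) :
    Continuous fun T : K →L[ℂ] K => (⟪φ, T φ⟫_ℂ).re := by
  fun_prop

/-- The condition cuts out a half-space, convex and closed in operator norm, hence stable under the
trace norm closure. -/
theorem re_inner_le_one_of_mem_traceClosedConvexHull {C : Set (K →L[ℂ] K)} {φ : K}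
    (hC : ∀ T ∈ C, (⟪φ, T φ⟫_ℂ).re ≤ 1) {T : K →L[ℂ] K} (hT : T ∈ traceClosedConvexHull C) :
    (⟪φ, T φ⟫_ℂ).re ≤ 1 := by
  have hcl : T ∈ closure (convexHull ℝ C) := by
    refine Metric.mem_closure_iff.2 fun ε hε => ?_
    obtain ⟨S, hS, h⟩ := hT (ENNReal.ofReal ε) (ENNReal.ofReal_pos.2 hε)
    refine ⟨S, hS, ?_⟩
    rw [dist_eq_norm]
    exact (ENNReal.ofReal_lt_ofReal_iff hε).1 ((ofReal_norm_le_traceNorm _).trans_lt h)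
  refine closure_minimal (t := {S : K →L[ℂ] K | (⟪φ, S φ⟫_ℂ).re ≤ 1}) (convexHull_min hC ?_)
    (isClosed_le (continuous_re_inner_apply φ) continuous_const) hcl
  intro S hS S' hS' a b ha hb hab
  simp only [Set.mem_ofPred_eq] at hS hS' ⊢
  have : (⟪φ, (a • S + b • S') φ⟫_ℂ).re = a * (⟪φ, S φ⟫_ℂ).re + b * (⟪φ, S' φ⟫_ℂ).re := by
    rw [← Complex.coe_smul a S, ← Complex.coe_smul b S', add_apply, smul_apply, smul_apply,
      inner_add_right, inner_smul_right, inner_smul_right, Complex.add_re, Complex.re_ofReal_mul,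
      Complex.re_ofReal_mul]
  rw [this]
  nlinarith

/-- A vector `φ` with `⟨φ, σ φ⟩ ≤ 1` on the free states bounds the robustness from below. -/
theorem le_robustness_of_witness {F : Set (K →L[ℂ] K)} {φ : K}
    (hF : ∀ T ∈ F, (⟪φ, T φ⟫_ℂ).re ≤ 1) (ρ : K →L[ℂ] K) :
    ENNReal.ofReal (⟪φ, ρ φ⟫_ℂ).re ≤ robustness F ρ := by
  refine le_sInf ?_
  rintro x ⟨r, hr, rfl, ξ, τ, hξ, h⟩
  refine ENNReal.ofReal_le_ofReal ?_
  have hlim : Tendsto ξ atTop (𝓝 ρ) := by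
    rw [tendsto_iff_norm_sub_tendsto_zero]
    have h' : Tendsto (fun k => ENNReal.ofReal ‖ξ k - ρ‖) atTop (𝓝 0) :=
      tendsto_of_tendsto_of_tendsto_of_le_of_le tendsto_const_nhds hξ (fun _ => zero_le)
        fun k => ofReal_norm_le_traceNorm _
    have := (ENNReal.tendsto_toReal ENNReal.zero_ne_top).comp h'
    simpa [Function.comp_def] using this
  refine le_of_tendsto' (((continuous_re_inner_apply φ).tendsto ρ).comp hlim) fun k => ?_
  obtain ⟨⟨hτ, -⟩, hk⟩ := h k
  have h1 := hF _ hk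
  have h2 : 0 ≤ (⟪φ, τ k φ⟫_ℂ).re := hτ.re_inner_nonneg_right φ
  have hr' : (0 : ℝ) < 1 + r := by positivity
  rw [← Complex.ofReal_inv, smul_apply, add_apply, smul_apply, inner_smul_right, inner_add_right,
    inner_smul_right, Complex.re_ofReal_mul, Complex.add_re, Complex.re_ofReal_mul,
    inv_mul_le_iff₀ hr', mul_one] at h1
  have := mul_nonneg hr h2
  simp only [Function.comp_apply]
  linarith

/-- An upper bound for the robustness of a pure state from a free state dominating it. -/
theorem plainRobustness_proj_le {F : Set (K →L[ℂ] K)} {ψ : K} (hψ : ‖ψ‖ = 1) {σ : K →L[ℂ] K}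
    (hσF : σ ∈ F) (hσ : σ.IsPositive) (htr : posTrace σ = 1) {M : ℝ} (hM : 1 ≤ M)
    (hdom : ∀ x, ‖⟪ψ, x⟫_ℂ‖ ^ 2 ≤ M * (⟪x, σ x⟫_ℂ).re) :
    plainRobustness F (proj ψ) ≤ ENNReal.ofReal M := by
  -- Working with every `t > M` keeps `t - 1 > 0`, so normalizing by the trace is legitimate even
  -- when `M = 1`.
  refine le_of_forall_gt_imp_ge_of_dense fun y hy => ?_
  rcases eq_or_ne y ⊤ with rfl | hy'
  · exact le_top
  lift y to NNReal using hy'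
  obtain ⟨t, ht⟩ : ∃ t : ℝ, (y : ℝ) = t := ⟨_, rfl⟩
  have hMt : M < t := by
    rw [ENNReal.ofReal_lt_coe_iff (by linarith)] at hy
    rwa [← ht]
  have hr : 0 < t - 1 := by linarith
  set T : K →L[ℂ] K := (t : ℂ) • σ - proj ψ with hT
  have htσ : ((t : ℂ) • σ).IsPositive :=
    hσ.smul_of_nonneg (by exact_mod_cast (by linarith : (0 : ℝ) ≤ t))
  have hpψ : (proj ψ).IsPositive := InnerProductSpace.isPositive_rankOne_self ψ
  have hTpos : T.IsPositive := by
    refine ContinuousLinearMap.isPositive_def'.2 ⟨htσ.isSelfAdjoint.sub hpψ.isSelfAdjoint, fun x => ?_⟩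
    rw [ContinuousLinearMap.reApplyInnerSelf_apply, inner_re_symm]
    have h1 : RCLike.re ⟪x, T x⟫_ℂ = t * (⟪x, σ x⟫_ℂ).re - ‖⟪ψ, x⟫_ℂ‖ ^ 2 := by
      change (⟪x, T x⟫_ℂ).re = _
      rw [hT, sub_apply, smul_apply, inner_sub_right, inner_smul_right, Complex.sub_re,
        Complex.re_ofReal_mul, proj, InnerProductSpace.rankOne_apply, inner_smul_right,
        ← inner_conj_symm x ψ, Complex.mul_conj']
      norm_cast
    have h2 : 0 ≤ (⟪x, σ x⟫_ℂ).re := hσ.re_inner_nonneg_right x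
    rw [h1]
    nlinarith [hdom x]
  -- Additivity on `T + |ψ⟩⟨ψ| = t σ` gives `Tr T + 1 = t`, from which the finite `1` cancels.
  have htrT : posTrace T = ENNReal.ofReal (t - 1) := by
    have h := posTrace_add hTpos hpψ
    rw [hT, sub_add_cancel, posTrace_real_smul (by linarith), htr, posTrace_proj hψ, mul_one] at h
    rw [ENNReal.ofReal_sub _ zero_le_one, ENNReal.ofReal_one, h,
      ENNReal.add_sub_cancel_right ENNReal.one_ne_top]
  refine sInf_le ⟨t - 1, hr.le, ?_, ((t - 1 : ℝ) : ℂ)⁻¹ • T, ⟨?_, ?_⟩, ?_⟩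
  · rw [add_sub_cancel, ← ht, ENNReal.ofReal_coe_nnreal]
  · rw [← Complex.ofReal_inv]
    exact hTpos.smul_of_nonneg (by exact_mod_cast (inv_pos.2 hr).le)
  · rw [← Complex.ofReal_inv, posTrace_real_smul (inv_pos.2 hr).le, htrT,
      ← ENNReal.ofReal_mul (inv_pos.2 hr).le, inv_mul_cancel₀ hr.ne', ENNReal.ofReal_one]
  · have h1 : ((t - 1 : ℝ) : ℂ) ≠ 0 := by exact_mod_cast hr.ne'
    have h2 : (t : ℂ) ≠ 0 := by
      have : t ≠ 0 := by linarith
      exact_mod_cast this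
    rwa [smul_inv_smul₀ h1, hT, add_sub_cancel, add_sub_cancel, inv_smul_smul₀ h2]

end Robustness

/-! ### Schmidt decompositions and separable states -/

section Schmidt

variable {A B : Type*} [NormedAddCommGroup A] [InnerProductSpace ℂ A]
  [NormedAddCommGroup B] [InnerProductSpace ℂ B]

theorem inner_tensorVec (a a' : A) (b b' : B) :
    ⟪tensorVec a b, tensorVec a' b'⟫_ℂ = ⟪a, a'⟫_ℂ * ⟪b, b'⟫_ℂ := by
  rw [tensorVec, tensorVec, UniformSpace.Completion.inner_coe, TensorProduct.inner_tmul]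

variable {ι : Type*} {e : ι → A} {f : ι → B}

theorem orthonormal_tensorVec (he : Orthonormal ℂ e) (hf : Orthonormal ℂ f) :
    Orthonormal ℂ fun n => tensorVec (e n) (f n) := by
  classical
  rw [orthonormal_iff_ite] at *
  intro i j
  rw [inner_tensorVec, he, hf]
  by_cases h : i = j <;> simp [h]

/-- The unnormalized maximally entangled vector has overlap at most one with product vectors. -/
theorem norm_inner_sum_tensorVec_le (he : Orthonormal ℂ e) (hf : Orthonormal ℂ f) (s : Finset ι)
    {a : A} {b : B} (ha : ‖a‖ = 1) (hb : ‖b‖ = 1) :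
    ‖⟪∑ n ∈ s, tensorVec (e n) (f n), tensorVec a b⟫_ℂ‖ ≤ 1 := by
  simp_rw [sum_inner, inner_tensorVec]
  calc ‖∑ n ∈ s, ⟪e n, a⟫_ℂ * ⟪f n, b⟫_ℂ‖ ≤ ∑ n ∈ s, ‖⟪e n, a⟫_ℂ‖ * ‖⟪f n, b⟫_ℂ‖ :=
        (norm_sum_le _ _).trans_eq (Finset.sum_congr rfl fun _ _ => norm_mul _ _)
    _ ≤ √(∑ n ∈ s, ‖⟪e n, a⟫_ℂ‖ ^ 2) * √(∑ n ∈ s, ‖⟪f n, b⟫_ℂ‖ ^ 2) :=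
        Real.sum_mul_le_sqrt_mul_sqrt _ _ _
    _ ≤ √1 * √1 := by
        gcongr
        · simpa [ha] using he.sum_inner_products_le a (s := s)
        · simpa [hb] using hf.sum_inner_products_le b (s := s)
    _ = 1 := by simp

theorem re_inner_le_one_of_mem_separableStates (he : Orthonormal ℂ e) (hf : Orthonormal ℂ f)
    (s : Finset ι) {σ : HilbertTensor A B →L[ℂ] HilbertTensor A B} (hσ : σ ∈ separableStates A B) :
    (⟪∑ n ∈ s, tensorVec (e n) (f n), σ (∑ n ∈ s, tensorVec (e n) (f n))⟫_ℂ).re ≤ 1 := by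
  refine re_inner_le_one_of_mem_traceClosedConvexHull ?_ hσ
  rintro _ ⟨a, b, ha, hb, rfl⟩
  have h := norm_inner_sum_tensorVec_le he hf s ha hb
  rw [proj, InnerProductSpace.rankOne_apply, inner_smul_right, ← inner_conj_symm, Complex.conj_mul']
  rw [← Complex.ofReal_pow, Complex.ofReal_re]
  exact pow_le_one₀ (norm_nonneg _) h

variable {ψ : HilbertTensor A B} {μ : ι → ℝ}

namespace IsSchmidtDecomposition

theorem inner_tensorVec_left (h : IsSchmidtDecomposition ψ μ e f) (n : ι) :
    ⟪tensorVec (e n) (f n), ψ⟫_ℂ = μ n := by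
  classical
  have hg := orthonormal_tensorVec h.orthonormal_left h.orthonormal_right
  refine (h.hasSum.mapL (innerSL ℂ (tensorVec (e n) (f n)))).unique ?_
  refine HasSum.congr_fun (hasSum_ite_eq n (μ n : ℂ)) fun m => ?_
  rw [innerSL_apply_apply, inner_smul_right, orthonormal_iff_ite.1 hg]
  by_cases hm : m = n
  · simp [hm]
  · simp [hm, Ne.symm hm]

theorem hasSum_inner (h : IsSchmidtDecomposition ψ μ e f) (x : HilbertTensor A B) :
    HasSum (fun n => (μ n : ℂ) * ⟪x, tensorVec (e n) (f n)⟫_ℂ) ⟪x, ψ⟫_ℂ := by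
  simpa [inner_smul_right] using h.hasSum.mapL (innerSL ℂ x)

theorem hasSum_sq (h : IsSchmidtDecomposition ψ μ e f) :
    HasSum (fun n => μ n ^ 2) (‖ψ‖ ^ 2) := by
  have h1 := h.hasSum_inner ψ
  rw [inner_self_eq_norm_sq_to_K] at h1
  have h2 : ∀ n, (μ n : ℂ) * ⟪ψ, tensorVec (e n) (f n)⟫_ℂ = ((μ n ^ 2 : ℝ) : ℂ) := fun n => by
    rw [← inner_conj_symm, h.inner_tensorVec_left, Complex.conj_ofReal]
    push_cast
    ring
  simp_rw [h2] at h1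
  exact Complex.hasSum_ofReal.1 (by simpa using h1)

/-- Witnesses use finite `s` because `∑ e n ⊗ f n` need not converge; the limit over `s` is taken in
`[0, ∞]`, which also covers divergent `∑ μ n`. -/
theorem le_robustness (h : IsSchmidtDecomposition ψ μ e f) :
    (∑' n, ENNReal.ofReal (μ n)) ^ 2 ≤ robustness (separableStates A B) (proj ψ) := by
  have key (s : Finset ι) : (∑ n ∈ s, ENNReal.ofReal (μ n)) ^ 2 ≤
      robustness (separableStates A B) (proj ψ) := by
    refine le_trans (le_of_eq ?_) (le_robustness_of_witness (fun σ hσ =>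
      re_inner_le_one_of_mem_separableStates h.orthonormal_left h.orthonormal_right s hσ) (proj ψ))
    have hs : ⟪∑ n ∈ s, tensorVec (e n) (f n), ψ⟫_ℂ = ((∑ n ∈ s, μ n : ℝ) : ℂ) := by
      rw [sum_inner, Complex.ofReal_sum]
      exact Finset.sum_congr rfl fun n _ => h.inner_tensorVec_left n
    rw [proj, InnerProductSpace.rankOne_apply, inner_smul_right, ← inner_conj_symm ψ, hs,
      Complex.conj_ofReal, ← Complex.ofReal_mul, Complex.ofReal_re,
      ENNReal.ofReal_mul (Finset.sum_nonneg fun n _ => h.nonneg n),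
      ENNReal.ofReal_sum_of_nonneg fun n _ => h.nonneg n, sq]
  have hlim : Tendsto (fun s : Finset ι => (∑ n ∈ s, ENNReal.ofReal (μ n)) ^ 2) atTop
      (𝓝 ((∑' n, ENNReal.ofReal (μ n)) ^ 2)) :=
    ENNReal.Tendsto.pow ENNReal.summable.hasSum
  exact le_of_tendsto' hlim key

theorem plainRobustness_le (h : IsSchmidtDecomposition ψ μ e f) (hψ : ‖ψ‖ = 1) (hμ : Summable μ) :
    plainRobustness (separableStates A B) (proj ψ) ≤ ENNReal.ofReal ((∑' n, μ n) ^ 2) := by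
  have hg := orthonormal_tensorVec h.orthonormal_left h.orthonormal_right
  set M := ∑' n, μ n with hM
  -- Triangle inequality for the Schmidt series: `1 = ‖ψ‖ ≤ ∑ μ n`.
  have hM1 : 1 ≤ M := by
    rw [← hψ, ← h.hasSum.tsum_eq]
    have hn : ∀ n, ‖(μ n : ℂ) • tensorVec (e n) (f n)‖ = μ n := fun n => by
      rw [norm_smul, hg.1, mul_one, Complex.norm_real, Real.norm_of_nonneg (h.nonneg n)]
    refine (norm_tsum_le_tsum_norm (by simpa only [hn] using hμ)).trans_eq ?_
    simp_rw [hn, hM]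
  have hM0 : 0 < M := by linarith
  have hp : HasSum (fun n => μ n / M) 1 := by
    simpa [← hM, div_self hM0.ne'] using hμ.hasSum.div_const M
  have hp0 : ∀ n, 0 ≤ μ n / M := fun n => div_nonneg (h.nonneg n) hM0.le
  have hsep : diagonalOperator (fun n => tensorVec (e n) (f n)) (fun n => μ n / M) ∈
      separableStates A B :=
    diagonalOperator_mem_traceClosedConvexHull hg hp0 hp fun n =>
      ⟨e n, f n, h.orthonormal_left.1 n, h.orthonormal_right.1 n, rfl⟩
  refine plainRobustness_proj_le hψ hsep
    (isPositive_diagonalOperator hg hp.summable hp0) ?_ (one_le_pow₀ hM1) fun x => ?_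
  · rw [posTrace_diagonalOperator hg hp.summable hp0, ← ENNReal.ofReal_tsum_of_nonneg hp0 hp.summable,
      hp.tsum_eq, ENNReal.ofReal_one]
  · have hq := hasSum_inner_diagonalOperator hg hp.summable x
    set q := (⟪x, diagonalOperator (fun n => tensorVec (e n) (f n)) (fun n => μ n / M) x⟫_ℂ).re
    rw [norm_inner_symm]
    refine le_of_tendsto' ((h.hasSum_inner x).norm.pow 2) fun s => ?_
    set u : ι → ℝ := fun n => ‖⟪tensorVec (e n) (f n), x⟫_ℂ‖ with hu
    have h1 : ‖∑ n ∈ s, (μ n : ℂ) * ⟪x, tensorVec (e n) (f n)⟫_ℂ‖ ≤ ∑ n ∈ s, μ n * u n := by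
      refine (norm_sum_le _ _).trans_eq (Finset.sum_congr rfl fun n _ => ?_)
      rw [norm_mul, Complex.norm_real, Real.norm_of_nonneg (h.nonneg n), norm_inner_symm]
    -- Cauchy–Schwarz with weights `μ n`. One factor `M` comes from the total weight, the other from
    -- the normalization `μ n / M` in `q`.
    have h2 : (∑ n ∈ s, μ n * u n) ^ 2 ≤ (∑ n ∈ s, μ n) * ∑ n ∈ s, μ n * u n ^ 2 :=
      Finset.sum_sq_le_sum_mul_sum_of_sq_le_mul s (fun n _ => h.nonneg n)
        (fun n _ => mul_nonneg (h.nonneg n) (sq_nonneg _)) fun n _ => le_of_eq (by ring)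
    have h3 : ∑ n ∈ s, μ n ≤ M := hμ.sum_le_tsum s fun n _ => h.nonneg n
    have h4 : ∑ n ∈ s, μ n * u n ^ 2 ≤ M * q := by
      have := sum_le_hasSum s (fun n _ => mul_nonneg (hp0 n) (sq_nonneg _)) hq
      rw [← div_le_iff₀' hM0, Finset.sum_div]
      refine le_trans (le_of_eq (Finset.sum_congr rfl fun n _ => ?_)) this
      ring
    calc _ ≤ (∑ n ∈ s, μ n * u n) ^ 2 := by gcongr
      _ ≤ (∑ n ∈ s, μ n) * ∑ n ∈ s, μ n * u n ^ 2 := h2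
      _ ≤ M * (M * q) := mul_le_mul h3 h4
          (Finset.sum_nonneg fun n _ => mul_nonneg (h.nonneg n) (sq_nonneg _)) hM0.le
      _ = M ^ 2 * q := by ring

theorem tsum_ofReal_ne_top_iff (h : IsSchmidtDecomposition ψ μ e f) :
    ∑' n, ENNReal.ofReal (μ n) ≠ ⊤ ↔ Summable μ := by
  refine ⟨fun ht => ?_, fun hs => hs.tsum_ofReal_ne_top⟩
  refine (ENNReal.summable_toReal ht).congr fun n => ?_
  rw [ENNReal.toReal_ofReal (h.nonneg n)]

theorem plainRobustness_le_sq_tsum (h : IsSchmidtDecomposition ψ μ e f) (hψ : ‖ψ‖ = 1) :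
    plainRobustness (separableStates A B) (proj ψ) ≤ (∑' n, ENNReal.ofReal (μ n)) ^ 2 := by
  by_cases hμ : Summable μ
  · refine (h.plainRobustness_le hψ hμ).trans_eq ?_
    rw [ENNReal.ofReal_pow (tsum_nonneg h.nonneg), ENNReal.ofReal_tsum_of_nonneg h.nonneg hμ]
  · rw [← h.tsum_ofReal_ne_top_iff, not_not] at hμ
    simp [hμ]

theorem robustness_eq (h : IsSchmidtDecomposition ψ μ e f) (hψ : ‖ψ‖ = 1) :
    robustness (separableStates A B) (proj ψ) = (∑' n, ENNReal.ofReal (μ n)) ^ 2 :=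
  le_antisymm ((robustness_le_plainRobustness _ _).trans (h.plainRobustness_le_sq_tsum hψ))
    h.le_robustness

theorem plainRobustness_eq (h : IsSchmidtDecomposition ψ μ e f) (hψ : ‖ψ‖ = 1) :
    plainRobustness (separableStates A B) (proj ψ) = (∑' n, ENNReal.ofReal (μ n)) ^ 2 :=
  le_antisymm (h.plainRobustness_le_sq_tsum hψ)
    (h.le_robustness.trans (robustness_le_plainRobustness _ _))

end IsSchmidtDecomposition

/-! ### The two-mode squeezed vacuum -/

theorem tanh_nonneg_of_nonneg {x : ℝ} (hx : 0 ≤ x) : 0 ≤ Real.tanh x := by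
  rw [Real.tanh_eq_sinh_div_cosh]
  exact div_nonneg (Real.sinh_nonneg_iff.2 hx) (Real.cosh_pos x).le

theorem tanh_lt_one (x : ℝ) : Real.tanh x < 1 := by
  rw [Real.tanh_eq_sinh_div_cosh, div_lt_one (Real.cosh_pos x)]
  exact Real.sinh_lt_cosh x

/-- A geometric series, evaluated through `(1 - tanh x) cosh x = cosh x - sinh x = exp (-x)`. At `x
= r / 2`, squaring gives `exp r`. -/
theorem hasSum_tanh_pow_div_cosh {x : ℝ} (hx : 0 ≤ x) :
    HasSum (fun n : ℕ => Real.tanh x ^ n / Real.cosh x) (Real.exp x) := by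
  have hc := (Real.cosh_pos x).ne'
  have h1 : (1 - Real.tanh x) * Real.cosh x = Real.exp (-x) := by
    rw [Real.tanh_eq_sinh_div_cosh, sub_mul, div_mul_cancel₀ _ hc, one_mul, Real.cosh_sub_sinh]
  have h2 : Real.exp x = (1 - Real.tanh x)⁻¹ / Real.cosh x := by
    rw [div_eq_mul_inv, ← mul_inv, h1, Real.exp_neg, inv_inv]
  rw [h2]
  exact (hasSum_geometric_of_lt_one (tanh_nonneg_of_nonneg hx) (tanh_lt_one x)).div_const _

theorem hasSum_sq_tanh_pow_div_cosh {x : ℝ} (hx : 0 ≤ x) :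
    HasSum (fun n : ℕ => (Real.tanh x ^ n / Real.cosh x) ^ 2) 1 := by
  have h0 := tanh_nonneg_of_nonneg hx
  have hc := (Real.cosh_pos x).ne'
  have h1 : (1 - Real.tanh x ^ 2) * Real.cosh x ^ 2 = 1 := by
    rw [Real.tanh_eq_sinh_div_cosh, div_pow, sub_mul, div_mul_cancel₀ _ (pow_ne_zero 2 hc), one_mul,
      Real.cosh_sq_sub_sinh_sq]
  have h2 : (1 : ℝ) = (1 - Real.tanh x ^ 2)⁻¹ / Real.cosh x ^ 2 := by
    rw [div_eq_mul_inv, ← mul_inv, h1, inv_one]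
  rw [h2]
  refine HasSum.congr_fun ((hasSum_geometric_of_lt_one (sq_nonneg (Real.tanh x))
    (pow_lt_one₀ h0 (tanh_lt_one x) two_ne_zero)).div_const (Real.cosh x ^ 2)) fun n => ?_
  rw [div_pow, ← pow_mul, ← pow_mul, mul_comm]

theorem isSchmidtDecomposition_twoModeSqueezedVacuum (b₁ : HilbertBasis ℕ ℂ A)
    (b₂ : HilbertBasis ℕ ℂ B) {r : ℝ} (hr : 0 ≤ r) :
    IsSchmidtDecomposition (twoModeSqueezedVacuum b₁ b₂ r)
      (fun n => Real.tanh (r / 2) ^ n / Real.cosh (r / 2)) b₁ b₂ where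
  nonneg n := div_nonneg (pow_nonneg (tanh_nonneg_of_nonneg (by positivity)) n) (Real.cosh_pos _).le
  orthonormal_left := b₁.orthonormal
  orthonormal_right := b₂.orthonormal
  hasSum := by
    have hg := orthonormal_tensorVec b₁.orthonormal b₂.orthonormal
    refine (Summable.of_norm ?_).hasSum
    refine (hasSum_tanh_pow_div_cosh (x := r / 2) (by positivity)).summable.norm.congr fun n => ?_
    rw [norm_smul, hg.1, mul_one, Complex.norm_real]

theorem norm_twoModeSqueezedVacuum (b₁ : HilbertBasis ℕ ℂ A)
    (b₂ : HilbertBasis ℕ ℂ B) {r : ℝ} (hr : 0 ≤ r) : ‖twoModeSqueezedVacuum b₁ b₂ r‖ = 1 := by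
  have h := (isSchmidtDecomposition_twoModeSqueezedVacuum b₁ b₂ hr).hasSum_sq.unique
    (hasSum_sq_tanh_pow_div_cosh (by positivity))
  exact (pow_eq_one_iff_of_nonneg (norm_nonneg _) two_ne_zero).1 h

theorem sq_tsum_tanh_pow_div_cosh {r : ℝ} (hr : 0 ≤ r) :
    (∑' n : ℕ, ENNReal.ofReal (Real.tanh (r / 2) ^ n / Real.cosh (r / 2))) ^ 2 =
      ENNReal.ofReal (Real.exp r) := by
  have h := hasSum_tanh_pow_div_cosh (x := r / 2) (by positivity)
  rw [← ENNReal.ofReal_tsum_of_nonneg (fun n => div_nonneg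
    (pow_nonneg (tanh_nonneg_of_nonneg (by positivity)) n) (Real.cosh_pos _).le) h.summable,
    h.tsum_eq, ← ENNReal.ofReal_pow (Real.exp_pos _).le, ← Real.exp_nat_mul]
  congr 2
  push_cast
  ring

end Schmidt
end QuantumRobustness

theorem mainTheorem5 {A B : Type*}
    [NormedAddCommGroup A] [InnerProductSpace ℂ A] [CompleteSpace A]
    [NormedAddCommGroup B] [InnerProductSpace ℂ B] [CompleteSpace B] :
    (∀ {ι : Type*} (ψ : QuantumRobustness.HilbertTensor A B) (μ : ι → ℝ) (e : ι → A) (f : ι → B),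
      ‖ψ‖ = 1 → QuantumRobustness.IsSchmidtDecomposition ψ μ e f →
        QuantumRobustness.robustness (QuantumRobustness.separableStates A B)
            (QuantumRobustness.proj ψ) = (∑' n, ENNReal.ofReal (μ n)) ^ 2 ∧
        QuantumRobustness.plainRobustness (QuantumRobustness.separableStates A B)
            (QuantumRobustness.proj ψ) = (∑' n, ENNReal.ofReal (μ n)) ^ 2 ∧
        (QuantumRobustness.robustness (QuantumRobustness.separableStates A B)
            (QuantumRobustness.proj ψ) < ⊤ ↔ Summable μ)) ∧
    (∀ (b₁ : HilbertBasis ℕ ℂ A) (b₂ : HilbertBasis ℕ ℂ B) (r : ℝ), 0 ≤ r →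
      ‖QuantumRobustness.twoModeSqueezedVacuum b₁ b₂ r‖ = 1 ∧
      QuantumRobustness.robustness (QuantumRobustness.separableStates A B)
          (QuantumRobustness.proj (QuantumRobustness.twoModeSqueezedVacuum b₁ b₂ r)) =
        ENNReal.ofReal (Real.exp r) ∧
      QuantumRobustness.plainRobustness (QuantumRobustness.separableStates A B)
          (QuantumRobustness.proj (QuantumRobustness.twoModeSqueezedVacuum b₁ b₂ r)) =
        ENNReal.ofReal (Real.exp r)) := by
  refine ⟨fun ψ μ e f hψ h => ⟨h.robustness_eq hψ, h.plainRobustness_eq hψ, ?_⟩,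
    fun b₁ b₂ r hr => ?_⟩
  · rw [h.robustness_eq hψ, ← h.tsum_ofReal_ne_top_iff, lt_top_iff_ne_top]
    simp
  · have h := QuantumRobustness.isSchmidtDecomposition_twoModeSqueezedVacuum b₁ b₂ hr
    have hn := QuantumRobustness.norm_twoModeSqueezedVacuum b₁ b₂ hr
    rw [h.robustness_eq hn, h.plainRobustness_eq hn]
    exact ⟨hn, QuantumRobustness.sq_tsum_tanh_pow_div_cosh hr,
      QuantumRobustness.sq_tsum_tanh_pow_div_cosh hr⟩
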